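/- A chord diagram $D$ with $n$ chords is a partition of the points $1,\dots,2n$ on an oriented line into $n$ pairs (chords). The chords are numbered $1,\dots,n$ in the order of their left end-points. Two distinct chords intersect if exactly one end-point of one lies strictly between the end-points of the other; chord $i$ is contained in chord $j\ne i$ if both end-points of $i$ lie strictly between those of $j$. For an integer $N\ge 0$ let $V_N$ be the $(N+1)$-dimensional irreducible $\mathfrak{sl}_2$-module with basis $v_0,\dots,v_N$ and $F v_k=(k+1)v_{k+1}$, $E v_k=(N-k+1)v_{k-1}$, $H v_k=(N-2k)v_k$ (with $v_{-1}=v_{N+1}=0$). Put on each chord of $D$ the operator $$\hat B=F\otimes E+E\otimes F+\tfrac12 H\otimes H-\tfrac12 N(N+2)\,\mathrm{id}\otimes\mathrm{id}$$ on $V_N\otimes V_N$, the first tensor factor sitting at the left and the second at the right end-point of the chord, and let $D_N\colon V_N\to V_N$ be the operator obtained by composing the factors along the line, the leftmost end-point acting first. The $0$-framed colored Jones weight system $W_J$, normalized to be $1$ on the empty diagram, assigns to $D$ the polynomial $W_J(D)\in\mathbb Q[\lambda]$ with $$W_J(D)|_{\lambda=N}=\frac{1}{N+1}\operatorname{tr}(D_N)\qquad\text{for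 all integers } N\ge 0.$$ Let $\mathrm{IM}_J(D)$ be the $3n\times 3n$ matrix over $\mathbb Q[\lambda]$ whose $3\times 3$ block at position $(i,j)$ is $A_0$ if $i=j$; $A_-$ if $i<j$ and the chords $i,j$ intersect; $A_+$ if $i>j$ and the chords $i,j$ intersect; $A_c$ if chord $i$ is contained in chord $j$; and $0$ otherwise, where $$A_0=\begin{pmatrix}\lambda+2&0&0\\0&\lambda+2&1\\ \lambda&-\lambda-2&1\end{pmatrix},\quad A_-=\begin{pmatrix}0&0&0\\-1&-1&0\\0&0&0\end{pmatrix},\quad A_+=\begin{pmatrix}1&1&0\\0&0&0\\0&0&0\end{pmatrix},\quad A_c=\begin{pmatrix}1&1&0\\-1&-1&0\\0&0&0\end{pmatrix}.$$ **Theorem.** For every chord diagram $D$, the polynomial $W_J(D)$ exists (and is unique), and $$W_J(D)=\operatorname{Per}(\mathrm{IM}_J(D)),$$ where $\operatorname{Per}$ denotes the permanent. -/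

import Mathlib

open Polynomial

/-- A chord diagram with `m` chords on an oriented line: a fixed-point-free involution of the
`2 * m` end-points, which are numbered from left to right along the line. -/
structure ChordDiagram (m : ℕ) where
  /-- the other end-point of the chord through a given end-point -/
  partner : Fin (2 * m) → Fin (2 * m)
  partner_partner : ∀ p, partner (partner p) = p
  partner_ne : ∀ p, partner p ≠ p

namespace ChordDiagram

variable {m : ℕ} (D : ChordDiagram m)

/-- The chords of `D`; a chord is represented by its left end-point, so that the chords are
ordered from left to right. -/
abbrev Chord : Type := {p : Fin (2 * m) // p < D.partner p}

/-- The left end-point of a chord. -/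
def left (i : D.Chord) : Fin (2 * m) := i.1

/-- The right end-point of a chord. -/
def right (i : D.Chord) : Fin (2 * m) := D.partner i.1

/-- The chord through an end-point. -/
def chordOf (p : Fin (2 * m)) : D.Chord :=
  if h : p < D.partner p then ⟨p, h⟩
  else ⟨D.partner p, by
    rw [D.partner_partner]
    exact lt_of_le_of_ne (not_lt.mp h) (D.partner_ne p)⟩

/-- Chord `i` starts to the left of chord `j`, and the two chords intersect. -/
def CrossesFromLeft (i j : D.Chord) : Prop :=
  D.left i < D.left j ∧ D.left j < D.right i ∧ D.right i < D.right j

/-- Chord `i` is completely contained in chord `j`. -/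
def ContainedIn (i j : D.Chord) : Prop :=
  D.left j < D.left i ∧ D.right i < D.right j

instance (i j : D.Chord) : Decidable (D.CrossesFromLeft i j) :=
  inferInstanceAs (Decidable (_ ∧ _ ∧ _))

instance (i j : D.Chord) : Decidable (D.ContainedIn i j) :=
  inferInstanceAs (Decidable (_ ∧ _))

end ChordDiagram

/-! The blown-up intersection matrix; the variable `X` of `ℚ[X]` plays the role of `λ`. -/

noncomputable section

/-- The diagonal block `A_0`. -/
def blockZero : Matrix (Fin 3) (Fin 3) ℚ[X] :=
  !![X + 2, 0, 0;
     0, X + 2, 1;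
     X, -X - 2, 1]

/-- The block `A_-`. -/
def blockMinus : Matrix (Fin 3) (Fin 3) ℚ[X] :=
  !![0, 0, 0;
     -1, -1, 0;
     0, 0, 0]

/-- The block `A_+`. -/
def blockPlus : Matrix (Fin 3) (Fin 3) ℚ[X] :=
  !![1, 1, 0;
     0, 0, 0;
     0, 0, 0]

/-- The block `A_c`. -/
def blockContained : Matrix (Fin 3) (Fin 3) ℚ[X] :=
  !![1, 1, 0;
     -1, -1, 0;
     0, 0, 0]

namespace ChordDiagram

variable {m : ℕ} (D : ChordDiagram m)

/-- The `3 × 3` block of the blown-up intersection matrix at the position `(i, j)`: for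
intersecting chords, `A_-` if `i` comes before `j` and `A_+` if `i` comes after `j`. -/
def block (i j : D.Chord) : Matrix (Fin 3) (Fin 3) ℚ[X] :=
  if i = j then blockZero
  else if D.CrossesFromLeft i j then blockMinus
  else if D.CrossesFromLeft j i then blockPlus
  else if D.ContainedIn i j then blockContained
  else 0

/-- The blown-up intersection matrix `IM_J(D)`, whose size is three times the number of chords. -/
def blownUpMatrix : Matrix (D.Chord × Fin 3) (D.Chord × Fin 3) ℚ[X] :=
  Matrix.of fun a b => D.block a.1 b.1 a.2 b.2

end ChordDiagram

/-! The irreducible `sl₂`-module `V_N` of dimension `N + 1`, with basis `v_0, …, v_N`. Matrices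
act on column vectors: column `k` is the image of `v_k`. -/

/-- The lowering operator, `v_k ↦ (k + 1) v_{k+1}`. -/
def sl2F (N : ℕ) : Matrix (Fin (N + 1)) (Fin (N + 1)) ℚ :=
  Matrix.of fun i k => if (i : ℕ) = (k : ℕ) + 1 then (k : ℚ) + 1 else 0

/-- The raising operator, `v_k ↦ (N - k + 1) v_{k-1}`. -/
def sl2E (N : ℕ) : Matrix (Fin (N + 1)) (Fin (N + 1)) ℚ :=
  Matrix.of fun i k => if (i : ℕ) + 1 = (k : ℕ) then (N : ℚ) - (k : ℚ) + 1 else 0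

/-- The weight operator, `v_k ↦ (N - 2 k) v_k`. -/
def sl2H (N : ℕ) : Matrix (Fin (N + 1)) (Fin (N + 1)) ℚ :=
  Matrix.diagonal fun k => (N : ℚ) - 2 * (k : ℚ)

/-- Left tensor factors of the four summands of the `0`-framed chord operator
`F ⊗ E + E ⊗ F + (1/2) H ⊗ H - (N (N + 2) / 2) 1 ⊗ 1` on `V_N ⊗ V_N`; here `N (N + 2) / 2` is
the eigenvalue on `V_N` of the Casimir element `F E + E F + (1/2) H²`. -/
def chordOpLeft (N : ℕ) : Fin 4 → Matrix (Fin (N + 1)) (Fin (N + 1)) ℚ :=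
  ![sl2F N, sl2E N, (1 / 2 : ℚ) • sl2H N, (-((N : ℚ) * ((N : ℚ) + 2) / 2)) • 1]

/-- Right tensor factors of the four summands of the `0`-framed chord operator. -/
def chordOpRight (N : ℕ) : Fin 4 → Matrix (Fin (N + 1)) (Fin (N + 1)) ℚ :=
  ![sl2E N, sl2F N, sl2H N, 1]

namespace ChordDiagram

variable {m : ℕ} (D : ChordDiagram m)

/-- The operator placed at the end-point `p`, when `c` selects for every chord one of the four
summands of the chord operator. -/
def endpointOp (N : ℕ) (c : D.Chord → Fin 4) (p : Fin (2 * m)) :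
    Matrix (Fin (N + 1)) (Fin (N + 1)) ℚ :=
  if p < D.partner p then chordOpLeft N (c (D.chordOf p))
  else chordOpRight N (c (D.chordOf p))

/-- The operator on `V_N` obtained by placing the chord operator on every chord of `D` and
composing along the oriented line, the leftmost end-point acting first. -/
def lineOp (N : ℕ) : Matrix (Fin (N + 1)) (Fin (N + 1)) ℚ :=
  ∑ c : D.Chord → Fin 4, (List.ofFn fun p => D.endpointOp N c p).reverse.prod

/-- The `0`-framed `sl₂` weight system in the module `V_N`, divided by its value `N + 1` at the
empty diagram. -/
def sl2Weight (N : ℕ) : ℚ := (D.lineOp N).trace / ((N : ℚ) + 1)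

/-- `w` is a polynomial in `λ` whose value at `λ = N` is the normalized `0`-framed `sl₂` weight
of `D` in `V_N`, for all `N`. There is at most one such polynomial. -/
def IsColoredJonesWeight (w : ℚ[X]) : Prop :=
  ∀ N : ℕ, w.eval (N : ℚ) = D.sl2Weight N

theorem IsColoredJonesWeight.unique {D : ChordDiagram m} {w w' : ℚ[X]}
    (h : D.IsColoredJonesWeight w) (h' : D.IsColoredJonesWeight w') : w = w' := by
  refine Polynomial.eq_of_infinite_eval_eq w w'
    ((Set.infinite_range_of_injective (Nat.cast_injective (R := ℚ))).mono ?_)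
  rintro _ ⟨N, rfl⟩
  exact (h N).trans (h' N).symm

open Classical in
/-- The `0`-framed colored Jones weight system `W_J(D) ∈ ℚ[λ]`: the polynomial whose value at
every `λ = N` is the normalized `0`-framed `sl₂` weight of `D` in `V_N`. -/
def coloredJonesWeight : ℚ[X] :=
  if h : ∃ w : ℚ[X], D.IsColoredJonesWeight w then h.choose else 0

end ChordDiagram

end

namespace MvPolynomial

variable {σ R : Type*} [CommRing R]

theorem coeff_eq_zero_of_mem_supported {s : Set σ} {f : MvPolynomial σ R}
    (hf : f ∈ supported R s) {v : σ} (hv : v ∉ s) {d : σ →₀ ℕ} (hd : d v ≠ 0) :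
    coeff d f = 0 := by
  by_contra h
  refine hv (mem_supported.1 hf ?_)
  rw [Finset.mem_coe, mem_vars_iff_mem_support]
  exact ⟨d, mem_support_iff.2 h, Finsupp.mem_support_iff.2 hd⟩

variable (σ R) in
/-- The ideal generated by the squares of the variables. -/
noncomputable def squaresIdeal : Ideal (MvPolynomial σ R) :=
  Ideal.span (Set.range fun v : σ => (X v : MvPolynomial σ R) ^ 2)

theorem coeff_eq_zero_of_mem_squaresIdeal {f : MvPolynomial σ R} (hf : f ∈ squaresIdeal σ R) :
    ∀ d : σ →₀ ℕ, (∀ v, d v ≤ 1) → coeff d f = 0 := by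
  classical
  induction hf using Submodule.span_induction with
  | mem x h =>
    obtain ⟨v, rfl⟩ := h
    intro d hd
    rw [coeff_X_pow, if_neg]
    rintro rfl
    simpa using hd v
  | zero => simp
  | add x y _ _ hx hy =>
    intro d hd
    rw [coeff_add, hx d hd, hy d hd, add_zero]
  | smul a x _ hx =>
    intro d hd
    rw [smul_eq_mul, coeff_mul]
    refine Finset.sum_eq_zero fun p hp => ?_
    rw [hx p.2, mul_zero]
    intro v
    have := DFunLike.congr_fun (Finset.HasAntidiagonal.mem_antidiagonal.1 hp) v
    simp only [Finsupp.add_apply] at this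
    have := hd v
    omega

theorem coeff_eq_of_sub_mem_squaresIdeal {f g : MvPolynomial σ R}
    (h : f - g ∈ squaresIdeal σ R) {d : σ →₀ ℕ} (hd : ∀ v, d v ≤ 1) : coeff d f = coeff d g := by
  rw [← sub_eq_zero, ← coeff_sub]
  exact coeff_eq_zero_of_mem_squaresIdeal h d hd

theorem sq_mem_squaresIdeal (v : σ) : (X v : MvPolynomial σ R) ^ 2 ∈ squaresIdeal σ R :=
  Ideal.subset_span ⟨v, rfl⟩

theorem prod_mul_sub_mem {A ι : Type*} [CommRing A] {I : Ideal A} {s : Finset ι} {f g : ι → A}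
    (h : ∀ i ∈ s, f i - g i ∈ I) (a : A) : (∏ i ∈ s, f i) * a - (∏ i ∈ s, g i) * a ∈ I := by
  rw [← Ideal.Quotient.mk_eq_mk_iff_sub_mem, map_mul, map_mul, map_prod, map_prod]
  congr 1
  exact Finset.prod_congr rfl fun i hi => (Ideal.Quotient.mk_eq_mk_iff_sub_mem _ _).2 (h i hi)

theorem coeff_mul_of_isHomogeneous {f : MvPolynomial σ R} {n : ℕ} (hf : f.IsHomogeneous n)
    (g : MvPolynomial σ R) {d : σ →₀ ℕ} (hd : d.degree = n) :
    coeff d (f * g) = coeff d f * coeff 0 g := by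
  classical
  rw [coeff_mul, Finset.sum_eq_single (d, 0)]
  · rintro ⟨a, b⟩ hab hne
    rw [Finset.HasAntidiagonal.mem_antidiagonal] at hab
    simp only at hab ⊢
    by_contra h
    have ha : a.degree = n := by
      by_contra h'
      exact h (by rw [hf.coeff_eq_zero h', zero_mul])
    have hb : b.degree = 0 := by
      have := congrArg Finsupp.degree hab
      rw [map_add] at this
      omega
    rw [Finsupp.degree_eq_zero_iff] at hb
    subst hb
    rw [add_zero] at hab
    exact hne (by rw [hab])
  · intro h
    simp at h

theorem coeff_mul_prod_X_mul_add {ι : Type*} {u : ι → σ} (hu : Function.Injective u)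
    {G H : ι → MvPolynomial σ R} (hG : ∀ i, G i ∈ supported R (Set.range u)ᶜ)
    (hH : ∀ i, H i ∈ supported R (Set.range u)ᶜ) (d : σ →₀ ℕ) (s : Finset ι) :
    ∀ h ∈ supported R (Set.range u)ᶜ,
      coeff (d + ∑ i ∈ s, Finsupp.single (u i) 1) (h * ∏ i ∈ s, (X (u i) * G i + H i)) =
        coeff d (h * ∏ i ∈ s, G i) := by
  classical
  cases subsingleton_or_nontrivial R
  · intro h _
    exact Subsingleton.elim _ _
  induction s using Finset.induction_on with
  | empty => simp
  | insert a s ha ih =>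
    intro h hh
    rw [Finset.sum_insert ha, Finset.prod_insert ha, Finset.prod_insert ha,
      show h * ((X (u a) * G a + H a) * ∏ i ∈ s, (X (u i) * G i + H i)) =
        X (u a) * (h * G a * ∏ i ∈ s, (X (u i) * G i + H i)) +
          h * H a * ∏ i ∈ s, (X (u i) * G i + H i) by ring,
      coeff_add, add_left_comm, coeff_X_mul, ih _ (mul_mem hh (hG a)), mul_assoc]
    have hsub : supported R (Set.range u)ᶜ ≤ supported R {u a}ᶜ :=
      supported_mono (by simp)
    refine add_eq_left.2 (coeff_eq_zero_of_mem_supported (s := {u a}ᶜ) (v := u a) ?_ ?_ ?_)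
    · refine mul_mem (hsub (mul_mem hh (hH a))) (prod_mem fun i hi => ?_)
      refine add_mem (mul_mem (X_mem_supported.2 ?_) (hsub (hG i))) (hsub (hH i))
      rintro h
      exact ha (hu h ▸ hi)
    · simp
    · simp

theorem coeff_prod_sum_C_mul_X [Fintype σ] [DecidableEq σ] (M : Matrix σ σ R) :
    coeff (∑ v, Finsupp.single v 1) (∏ v, ∑ w, C (M w v) * X w) = M.permanent := by
  have key : ∀ f : σ → σ, (∑ v, Finsupp.single (f v) 1 : σ →₀ ℕ) = ∑ v, Finsupp.single v 1 ↔
      Function.Bijective f := by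
    intro f
    constructor
    · intro h
      rw [← Finite.surjective_iff_bijective]
      intro w
      have hw := DFunLike.congr_fun h w
      simp only [Finsupp.coe_finsetSum, Finset.sum_apply, Finsupp.single_apply] at hw
      by_contra! hne
      simp [hne] at hw
    · intro h
      exact Function.Bijective.sum_comp h fun v => Finsupp.single v 1
  rw [Finset.prod_univ_sum, coeff_sum, Fintype.piFinset_univ, Matrix.permanent]
  have hcoeff : ∀ f : σ → σ, coeff (∑ v, Finsupp.single v 1) (∏ v, (C (M (f v) v) * X (f v))) =
      if Function.Bijective f then ∏ v, M (f v) v else 0 := by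
    intro f
    rw [Finset.prod_mul_distrib, ← map_prod, coeff_C_mul,
      show (∏ v, X (f v) : MvPolynomial σ R) = monomial (∑ v, Finsupp.single (f v) 1) 1 by
        rw [monomial_sum_one]; rfl, coeff_monomial]
    simp [key]
  simp only [hcoeff]
  symm
  refine Finset.sum_of_injOn (fun π : Equiv.Perm σ => (π : σ → σ)) ?_ ?_ ?_ ?_
  · exact fun _ _ _ _ h => DFunLike.coe_injective h
  · simp
  · intro f _ hf
    rw [if_neg]
    intro hb
    exact hf ⟨Equiv.ofBijective f hb, by simp, rfl⟩
  · intro π _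
    simp

end MvPolynomial

theorem Matrix.permanent_mul_rows {n R : Type*} [DecidableEq n] [Fintype n] [CommRing R]
    (s : n → R) (M : Matrix n n R) :
    (Matrix.of fun i j => s i * M i j).permanent = (∏ i, s i) * M.permanent := by
  simp only [Matrix.permanent, Matrix.of_apply, Finset.prod_mul_distrib, Finset.mul_sum]
  exact Finset.sum_congr rfl fun π _ => by rw [Equiv.prod_comp π s]

noncomputable section

/-- The polynomial with a given vector of coefficients. -/
def vecPoly (N : ℕ) : (Fin (N + 1) → ℚ) →ₗ[ℚ] ℚ[X] where
  toFun v := ∑ k, C (v k) * X ^ (k : ℕ)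
  map_add' v w := by simp [add_mul, Finset.sum_add_distrib]
  map_smul' r v := by simp [Finset.smul_sum, smul_eq_C_mul, mul_assoc]

theorem vecPoly_apply (N : ℕ) (v : Fin (N + 1) → ℚ) :
    vecPoly N v = ∑ k, C (v k) * X ^ (k : ℕ) := rfl

theorem vecPoly_injective (N : ℕ) : Function.Injective (vecPoly N) := by
  intro v w h
  ext k
  have := congrArg (fun f => coeff f k) h
  simpa [vecPoly_apply, finsetSum_coeff, coeff_C_mul, coeff_X_pow, Fin.val_inj] using this

/-- The transpose of `M` acts on polynomials as the differential operator `a + b d/dX`. -/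
def ActsAs {N : ℕ} (M : Matrix (Fin (N + 1)) (Fin (N + 1)) ℚ) (a b : ℚ[X]) : Prop :=
  ∀ v, vecPoly N (M.transpose.mulVec v) = a * vecPoly N v + b * derivative (vecPoly N v)

theorem actsAs_iff {N : ℕ} (M : Matrix (Fin (N + 1)) (Fin (N + 1)) ℚ) (a b : ℚ[X]) :
    ActsAs M a b ↔ ∀ k : Fin (N + 1), vecPoly N (M k) =
      a * X ^ (k : ℕ) + b * (C (k : ℚ) * X ^ ((k : ℕ) - 1)) := by
  have hs : ∀ k : Fin (N + 1), vecPoly N (Pi.single k 1) = X ^ (k : ℕ) := by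
    intro k
    rw [vecPoly_apply, Finset.sum_eq_single k]
    · simp
    · intro j _ hj
      simp [Pi.single_eq_of_ne hj]
    · simp
  constructor
  · intro h k
    have := h (Pi.single k 1)
    rw [Matrix.mulVec_single_one, hs, derivative_X_pow] at this
    exact this
  · intro h
    let T : (Fin (N + 1) → ℚ) →ₗ[ℚ] ℚ[X] :=
      LinearMap.mulLeft ℚ a ∘ₗ vecPoly N + LinearMap.mulLeft ℚ b ∘ₗ derivative ∘ₗ vecPoly N
    have hT : vecPoly N ∘ₗ M.transpose.mulVecLin = T := by
      refine LinearMap.pi_ext' fun k => LinearMap.ext_ring ?_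
      simp only [LinearMap.comp_apply, LinearMap.single_apply, Matrix.mulVecLin_apply,
        Matrix.mulVec_single_one, T, LinearMap.add_apply, LinearMap.mulLeft_apply, hs,
        derivative_X_pow]
      exact h k
    exact fun v => LinearMap.congr_fun hT v

theorem ActsAs.smul {N : ℕ} {M : Matrix (Fin (N + 1)) (Fin (N + 1)) ℚ} {a b : ℚ[X]}
    (h : ActsAs M a b) (r : ℚ) : ActsAs (r • M) (C r * a) (C r * b) := by
  intro v
  rw [Matrix.transpose_smul, Matrix.smul_mulVec, map_smul, h v, smul_eq_C_mul]
  ring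

theorem actsAs_one (N : ℕ) : ActsAs (1 : Matrix (Fin (N + 1)) (Fin (N + 1)) ℚ) 1 0 := by
  intro v
  simp

theorem actsAs_sl2F (N : ℕ) : ActsAs (sl2F N) 0 1 := by
  rw [actsAs_iff]
  intro k
  rw [vecPoly_apply]
  rcases Nat.eq_zero_or_pos (k : ℕ) with hk | hk
  · simp [sl2F, hk]
  · have hk' := k.2
    rw [Finset.sum_eq_single ⟨(k : ℕ) - 1, by omega⟩]
    · simp [sl2F, Nat.sub_add_cancel hk, Nat.cast_sub hk]
    · intro j _ hj
      have : ¬ (k : ℕ) = (j : ℕ) + 1 := fun h => hj (Fin.ext (by simp [h]))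
      simp [sl2F, this]
    · simp

theorem actsAs_sl2E (N : ℕ) : ActsAs (sl2E N) (C (N : ℚ) * X) (-X ^ 2) := by
  rw [actsAs_iff]
  intro k
  have hrhs : C (N : ℚ) * X * X ^ (k : ℕ) + -X ^ 2 * (C (k : ℚ) * X ^ ((k : ℕ) - 1)) =
      C ((N : ℚ) - k) * X ^ ((k : ℕ) + 1) := by
    rcases Nat.eq_zero_or_pos (k : ℕ) with hk | hk
    · simp [hk]
    · obtain ⟨j, hj⟩ := Nat.exists_eq_add_of_le' hk
      rw [hj, Nat.add_sub_cancel, C_sub]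
      ring
  rw [hrhs, vecPoly_apply]
  have hk' := k.2
  rcases Nat.lt_or_ge (k : ℕ) N with hk | hk
  · rw [Finset.sum_eq_single ⟨(k : ℕ) + 1, by omega⟩]
    · simp only [sl2E, Matrix.of_apply, if_true]
      congr 2
      push_cast
      ring
    · intro j _ hj
      have : ¬ (k : ℕ) + 1 = (j : ℕ) := fun h => hj (Fin.ext (by simp [h]))
      simp [sl2E, this]
    · simp
  · have hN : (k : ℕ) = N := by omega
    rw [hN, sub_self, map_zero, zero_mul]
    refine Finset.sum_eq_zero fun j _ => ?_
    have hj := j.2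
    have : ¬ (k : ℕ) + 1 = (j : ℕ) := by omega
    simp [sl2E, this]

theorem actsAs_sl2H (N : ℕ) : ActsAs (sl2H N) (C (N : ℚ)) (-2 * X) := by
  rw [actsAs_iff]
  intro k
  rw [vecPoly_apply, Finset.sum_eq_single k]
  · rcases Nat.eq_zero_or_pos (k : ℕ) with hk | hk
    · simp [sl2H, hk]
    · obtain ⟨j, hj⟩ := Nat.exists_eq_add_of_le' hk
      simp only [sl2H, Matrix.diagonal_apply_eq]
      rw [hj, Nat.add_sub_cancel]
      simp only [map_sub, map_mul, map_natCast, map_ofNat]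
      ring
  · intro j _ hj
    simp [sl2H, Matrix.diagonal_apply_ne _ hj.symm]
  · simp

theorem exists_aeval_add_eq {A : Type*} [CommRing A] [Algebra ℚ A] (g : ℚ[X]) (x y : A) :
    ∃ c : A, aeval (x + y) g = aeval x g + aeval x (derivative g) * y + c * y ^ 2 := by
  obtain ⟨c, hc⟩ := exists_mul_sq_add_linear_part_eq_eval_add (g.map (algebraMap ℚ A)) x y
  refine ⟨c, ?_⟩
  rw [derivative_map, eval_map_algebraMap, eval_map_algebraMap, eval_map_algebraMap] at hc
  rw [← hc]
  ring

/-- The product of the differential operators `a p + b p d/dX`, the last of which acts first,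
computed by extracting the multilinear coefficient of a product of commuting factors. -/
theorem eval_vecPoly_reverse_prod {σ : Type*} {N : ℕ} (x : ℚ) :
    ∀ {n : ℕ} {e : Fin n → σ} (_ : Function.Injective e)
    {M : Fin n → Matrix (Fin (N + 1)) (Fin (N + 1)) ℚ} {a b : Fin n → ℚ[X]}
    (_ : ∀ p, ActsAs (M p) (a p) (b p)) (w : Fin (N + 1) → ℚ),
    eval x (vecPoly N ((List.ofFn M).reverse.prod.transpose.mulVec w)) =
      MvPolynomial.coeff (∑ p, Finsupp.single (e p) 1)
        ((∏ p, (MvPolynomial.X (e p) * aeval (MvPolynomial.C x +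
            ∑ q, if q < p then MvPolynomial.X (e q) else 0) (a p) +
          aeval (MvPolynomial.C x + ∑ q, if q < p then MvPolynomial.X (e q) else 0) (b p))) *
        aeval (MvPolynomial.C x + ∑ q, MvPolynomial.X (e q)) (vecPoly N w)) := by
  classical
  intro n
  induction n with
  | zero =>
    intro e _ M a b _ w
    have : (MvPolynomial.C x : MvPolynomial σ ℚ) = algebraMap ℚ _ x := rfl
    simp [this, aeval_algebraMap_apply]
  | succ n ih =>
    intro e he M a b hM w
    have he' : Function.Injective fun p : Fin n => e p.castSucc :=
      he.comp (Fin.castSucc_injective n)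
    rw [List.ofFn_succ', List.concat_eq_append, List.reverse_concat, List.prod_cons, Matrix.transpose_mul,
      ← Matrix.mulVec_mulVec, ih he' (fun p => hM p.castSucc), hM (Fin.last n) w]
    simp only [Fin.sum_univ_castSucc, Fin.prod_univ_castSucc, Fin.castSucc_lt_castSucc_iff,
      Fin.castSucc_lt_last, if_true, if_false, add_zero,
      not_lt_of_ge (Fin.le_last _)]
    set v := e (Fin.last n) with hv
    set S : MvPolynomial σ ℚ := MvPolynomial.C x + ∑ q : Fin n, MvPolynomial.X (e q.castSucc)
      with hS
    set P := ∏ p : Fin n, (MvPolynomial.X (e p.castSucc) * aeval (MvPolynomial.C x +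
            ∑ q : Fin n, if q < p then MvPolynomial.X (e q.castSucc) else 0) (a p.castSucc) +
          aeval (MvPolynomial.C x + ∑ q : Fin n, if q < p then
            (MvPolynomial.X (e q.castSucc) : MvPolynomial σ ℚ) else 0) (b p.castSucc)) with hP
    set d : σ →₀ ℕ := ∑ p : Fin n, Finsupp.single (e p.castSucc) 1 with hd
    have hne : ∀ p : Fin n, e p.castSucc ≠ v := fun p h => (Fin.castSucc_lt_last p).ne (he h)
    have hdv : d v = 0 := by
      simp [hd, Finsupp.finsetSum_apply, hne]
    obtain ⟨c, hc⟩ := exists_aeval_add_eq (vecPoly N w) S (MvPolynomial.X v)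
    set g := vecPoly N w
    rw [← add_assoc, ← hS, hc]
    have hX : ∀ p : Fin n, MvPolynomial.X (e p.castSucc) ∈ MvPolynomial.supported ℚ {v}ᶜ :=
      fun p => MvPolynomial.X_mem_supported.2 (hne p)
    have haeval : ∀ {y : MvPolynomial σ ℚ} (_ : y ∈ MvPolynomial.supported ℚ {v}ᶜ) (f : ℚ[X]),
        aeval y f ∈ MvPolynomial.supported ℚ {v}ᶜ := fun {y} hy f =>
      Algebra.adjoin_le (Set.singleton_subset_iff.2 hy) (aeval_mem_adjoin_singleton ℚ y)
    have hC : (MvPolynomial.C x : MvPolynomial σ ℚ) ∈ MvPolynomial.supported ℚ {v}ᶜ :=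
      Subalgebra.algebraMap_mem _ x
    have hSmem : S ∈ MvPolynomial.supported ℚ {v}ᶜ :=
      add_mem hC (sum_mem fun p _ => hX p)
    have hSp : ∀ p : Fin n, (MvPolynomial.C x + ∑ q : Fin n, if q < p then
        MvPolynomial.X (e q.castSucc) else 0) ∈ MvPolynomial.supported ℚ {v}ᶜ := fun p =>
      add_mem hC (sum_mem fun q _ => by split_ifs; exacts [hX q, zero_mem _])
    have hPmem : P ∈ MvPolynomial.supported ℚ {v}ᶜ :=
      prod_mem fun p _ => add_mem (mul_mem (hX p) (haeval (hSp p) _)) (haeval (hSp p) _)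
    rw [map_add, map_mul, map_mul]
    rw [show P * (MvPolynomial.X v * aeval S (a (Fin.last n)) + aeval S (b (Fin.last n))) *
        (aeval S g + aeval S (derivative g) * MvPolynomial.X v + c * MvPolynomial.X v ^ 2) =
        P * aeval S (b (Fin.last n)) * aeval S g +
        P * (aeval S (a (Fin.last n)) * aeval S g +
          aeval S (b (Fin.last n)) * aeval S (derivative g)) * MvPolynomial.X v +
        P * (aeval S (a (Fin.last n)) * aeval S (derivative g) + (MvPolynomial.X v *
          aeval S (a (Fin.last n)) + aeval S (b (Fin.last n))) * c) * MvPolynomial.X v *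
          MvPolynomial.X v by ring]
    rw [MvPolynomial.coeff_add, MvPolynomial.coeff_add, MvPolynomial.coeff_mul_X,
      MvPolynomial.coeff_mul_X]
    have h1 : MvPolynomial.coeff (d + Finsupp.single v 1)
        (P * aeval S (b (Fin.last n)) * aeval S g) = 0 :=
      MvPolynomial.coeff_eq_zero_of_mem_supported (s := {v}ᶜ) (v := v)
        (mul_mem (mul_mem hPmem (haeval hSmem _)) (haeval hSmem _)) (by simp) (by simp)
    rw [h1, MvPolynomial.coeff_mul_X', if_neg (by simp [hdv]), zero_add, add_zero]

end

namespace ChordDiagram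

variable {m : ℕ} (D : ChordDiagram m)

theorem left_lt_right (i : D.Chord) : D.left i < D.right i := i.2

theorem partner_left (i : D.Chord) : D.partner (D.left i) = D.right i := rfl

theorem partner_right (i : D.Chord) : D.partner (D.right i) = D.left i := D.partner_partner _

theorem chordOf_left (i : D.Chord) : D.chordOf (D.left i) = i := dif_pos i.2

theorem chordOf_right (i : D.Chord) : D.chordOf (D.right i) = i := by
  have h : ¬ D.right i < D.partner (D.right i) := by
    rw [partner_right]
    exact (D.left_lt_right i).not_gt
  rw [chordOf, dif_neg h]
  exact Subtype.ext (D.partner_right i)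

theorem left_injective : Function.Injective D.left := Subtype.val_injective

theorem right_injective : Function.Injective D.right := fun i j h => by
  rw [← D.chordOf_right i, h, chordOf_right]

@[to_additive]
theorem prod_endpoints {A : Type*} [CommMonoid A] (f : Fin (2 * m) → A) :
    ∏ p, f p = ∏ i : D.Chord, f (D.left i) * f (D.right i) := by
  classical
  rw [← Finset.prod_filter_mul_prod_filter_not Finset.univ (fun p => p < D.partner p),
    Finset.prod_mul_distrib]
  congr 1
  · exact Finset.prod_subtype _ (by simp) f
  · symm
    refine Finset.prod_nbij D.right ?_ D.right_injective.injOn ?_ fun _ _ => rfl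
    · intro i _
      simpa [partner_right] using (D.left_lt_right i).le
    · intro p hp
      have hp' : D.partner p < p := by
        simp only [Finset.coe_filter, Finset.mem_univ, true_and, Set.mem_ofPred_eq, not_lt] at hp
        exact lt_of_le_of_ne hp (D.partner_ne p)
      exact ⟨⟨D.partner p, by rwa [D.partner_partner]⟩, by simp, D.partner_partner p⟩

/-- The index of an end-point among three copies of the chords: copy `0` holds the left and
copy `1` the right end-points. -/
def endpointIndex (p : Fin (2 * m)) : D.Chord × Fin 3 :=
  (D.chordOf p, if p < D.partner p then 0 else 1)

theorem endpointIndex_left (i : D.Chord) : D.endpointIndex (D.left i) = (i, 0) := by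
  rw [endpointIndex, chordOf_left, partner_left, if_pos (D.left_lt_right i)]

theorem endpointIndex_right (i : D.Chord) : D.endpointIndex (D.right i) = (i, 1) := by
  rw [endpointIndex, chordOf_right, partner_right, if_neg (D.left_lt_right i).not_gt]

theorem endpointIndex_injective : Function.Injective D.endpointIndex := by
  have key : ∀ p, p = if (D.endpointIndex p).2 = 0 then D.left (D.endpointIndex p).1
      else D.right (D.endpointIndex p).1 := by
    intro p
    by_cases h : p < D.partner p
    · simp [endpointIndex, chordOf, h, left]
    · simp [endpointIndex, chordOf, h, right, D.partner_partner]
  intro p q h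
  rw [key p, h, ← key q]

theorem sum_single_univ_eq :
    (∑ v : D.Chord × Fin 3, Finsupp.single v 1 : D.Chord × Fin 3 →₀ ℕ) =
      ∑ p, Finsupp.single (D.endpointIndex p) 1 + ∑ i : D.Chord, Finsupp.single (i, 2) 1 := by
  rw [D.sum_endpoints, ← Finset.sum_add_distrib, Fintype.sum_prod_type]
  simp only [endpointIndex_left, endpointIndex_right, Fin.sum_univ_three]

noncomputable section

/-- The variable of the left end-point. -/
abbrev varLeft (i : D.Chord) : MvPolynomial (D.Chord × Fin 3) ℚ := MvPolynomial.X (i, 0)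

/-- The variable of the right end-point. -/
abbrev varRight (i : D.Chord) : MvPolynomial (D.Chord × Fin 3) ℚ := MvPolynomial.X (i, 1)

/-- The sum of the variables of all end-points strictly inside a chord. -/
def varInside (i : D.Chord) : MvPolynomial (D.Chord × Fin 3) ℚ :=
  ∑ q, if D.left i < q ∧ q < D.right i then MvPolynomial.X (D.endpointIndex q) else 0

/-- The sum of the variables of all end-points to the left of a given one. -/
def varBefore (p : Fin (2 * m)) : MvPolynomial (D.Chord × Fin 3) ℚ :=
  ∑ q, if q < p then MvPolynomial.X (D.endpointIndex q) else 0

theorem varBefore_right (i : D.Chord) :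
    D.varBefore (D.right i) = D.varBefore (D.left i) + D.varLeft i + D.varInside i := by
  have h : D.varLeft i = ∑ q, if q = D.left i then MvPolynomial.X (D.endpointIndex q) else 0 := by
    rw [Finset.sum_ite_eq' Finset.univ (D.left i), if_pos (Finset.mem_univ _), endpointIndex_left]
  rw [h, varBefore, varBefore, varInside, ← Finset.sum_add_distrib, ← Finset.sum_add_distrib]
  refine Finset.sum_congr rfl fun q _ => ?_
  have := D.left_lt_right i
  rcases lt_trichotomy q (D.left i) with hq | hq | hq
  · rw [if_pos (hq.trans this), if_pos hq, if_neg hq.ne, if_neg fun h => hq.not_gt h.1]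
    simp
  · subst hq
    rw [if_pos this, if_neg (lt_irrefl _), if_pos rfl, if_neg fun h => lt_irrefl _ h.1]
    simp
  · rw [if_neg hq.not_gt, if_neg hq.ne']
    simp [hq]

theorem varInside_eq (i : D.Chord) : D.varInside i = ∑ k : D.Chord,
    ((if D.left i < D.left k ∧ D.left k < D.right i then D.varLeft k else 0) +
      if D.left i < D.right k ∧ D.right k < D.right i then D.varRight k else 0) := by
  rw [varInside, D.sum_endpoints]
  simp only [endpointIndex_left, endpointIndex_right]

/-- The contribution of one chord to the weight system in the module `V_N`. -/
def chordFactor (N : ℕ) (i : D.Chord) : MvPolynomial (D.Chord × Fin 3) ℚ :=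
  MvPolynomial.C (N : ℚ) * D.varRight i * D.varInside i -
    MvPolynomial.C ((N : ℚ) + 2) * D.varLeft i * D.varInside i - D.varInside i ^ 2

/-- The sum of the rows of the matrix in one of the columns of chord `i`, the rows weighted by
variables that carry a sign in the second and third copies. -/
def columnForm (N : ℕ) (v : D.Chord × Fin 3) : MvPolynomial (D.Chord × Fin 3) ℚ :=
  ∑ w, MvPolynomial.C ((if w.2 = 0 then 1 else -1) * (D.blownUpMatrix w v).eval (N : ℚ)) *
    MvPolynomial.X w

theorem sum_block_column (N : ℕ) (i k : D.Chord) (c : Fin 3) :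
    (∑ r : Fin 3, MvPolynomial.C ((if r = 0 then 1 else -1) *
        (D.block k i r c).eval (N : ℚ)) * MvPolynomial.X (k, r) :
        MvPolynomial (D.Chord × Fin 3) ℚ) =
      (if k = i then ∑ r : Fin 3, MvPolynomial.C ((if r = 0 then 1 else -1) *
        (blockZero r c).eval (N : ℚ)) * MvPolynomial.X (i, r) else 0) +
      if c = 2 then 0 else
        (if D.left i < D.left k ∧ D.left k < D.right i then D.varLeft k else 0) +
          if D.left i < D.right k ∧ D.right k < D.right i then D.varRight k else 0 := by
  by_cases hk : k = i
  · subst hk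
    simp [block]
  · have h1 : D.left k ≠ D.left i := fun h => hk (D.left_injective h)
    have h2 : D.right k ≠ D.right i := fun h => hk (D.right_injective h)
    have h3 := D.left_lt_right k
    have h4 := D.left_lt_right i
    rw [if_neg hk, zero_add, block, if_neg hk]
    have hm : D.CrossesFromLeft k i ↔ ¬ (D.left i < D.left k ∧ D.left k < D.right i) ∧
        D.left i < D.right k ∧ D.right k < D.right i := by
      unfold CrossesFromLeft
      omega
    have hp : D.CrossesFromLeft i k ↔ (D.left i < D.left k ∧ D.left k < D.right i) ∧
        ¬ (D.left i < D.right k ∧ D.right k < D.right i) := by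
      unfold CrossesFromLeft
      omega
    have hc : D.ContainedIn k i ↔ (D.left i < D.left k ∧ D.left k < D.right i) ∧
        D.left i < D.right k ∧ D.right k < D.right i := by
      unfold ContainedIn
      omega
    simp only [hm, hp, hc]
    by_cases ha : D.left i < D.left k ∧ D.left k < D.right i <;>
    by_cases hb : D.left i < D.right k ∧ D.right k < D.right i <;>
    simp only [ha, hb, and_true, and_false, not_true, not_false_iff, if_true, if_false] <;>
    fin_cases c <;>
    simp [blockContained, blockPlus, blockMinus, Fin.sum_univ_three]

theorem columnForm_eq (N : ℕ) (i : D.Chord) (c : Fin 3) :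
    D.columnForm N (i, c) = (∑ r : Fin 3, MvPolynomial.C ((if r = 0 then 1 else -1) *
        (blockZero r c).eval (N : ℚ)) * MvPolynomial.X (i, r)) +
      if c = 2 then 0 else D.varInside i := by
  rw [columnForm, Fintype.sum_prod_type]
  simp only [blownUpMatrix, Matrix.of_apply, sum_block_column]
  rw [Finset.sum_add_distrib, Finset.sum_ite_eq', if_pos (Finset.mem_univ _)]
  congr 1
  split_ifs
  · simp
  · rw [varInside_eq]

theorem eval_permanent_blownUpMatrix (N : ℕ) :
    D.blownUpMatrix.permanent.eval (N : ℚ) = MvPolynomial.coeff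
      (∑ v, Finsupp.single v 1) (∏ v, D.columnForm N v) := by
  have h : D.blownUpMatrix.permanent.eval (N : ℚ) =
      (Matrix.of fun w v => (D.blownUpMatrix w v).eval (N : ℚ)).permanent := by
    simp [Matrix.permanent, eval_finsetSum, eval_prod]
  have hs : ∏ v : D.Chord × Fin 3, (if v.2 = 0 then (1 : ℚ) else -1) = 1 := by
    simp [Fintype.prod_prod_type, Fin.prod_univ_three]
  rw [h, ← one_mul (Matrix.permanent _), ← hs, ← Matrix.permanent_mul_rows,
    ← MvPolynomial.coeff_prod_sum_C_mul_X]
  rfl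

theorem varInside_mem_supported (i : D.Chord) :
    D.varInside i ∈ MvPolynomial.supported ℚ (Set.range fun k : D.Chord => (k, (2 : Fin 3)))ᶜ := by
  rw [varInside_eq]
  refine sum_mem fun k _ => add_mem ?_ ?_ <;> split_ifs <;>
    simp [MvPolynomial.X_mem_supported]

theorem eval_permanent_eq_coeff_chordFactor (N : ℕ) :
    D.blownUpMatrix.permanent.eval (N : ℚ) = MvPolynomial.coeff
      (∑ p, Finsupp.single (D.endpointIndex p) 1) (∏ i, D.chordFactor N i) := by
  let H : D.Chord → MvPolynomial (D.Chord × Fin 3) ℚ := fun i =>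
    -(MvPolynomial.C ((N : ℚ) + 2) * D.varLeft i + D.varInside i) * D.varInside i * D.varRight i
  let I := MvPolynomial.squaresIdeal (D.Chord × Fin 3) ℚ
  have hd : ∀ v : D.Chord × Fin 3,
      (∑ v : D.Chord × Fin 3, Finsupp.single v 1 : D.Chord × Fin 3 →₀ ℕ) v ≤ 1 := by
    intro v
    simp [Finsupp.finsetSum_apply, Finsupp.single_apply]
  have hcol : ∀ i ∈ Finset.univ, (∏ c, D.columnForm N (i, c)) -
      (MvPolynomial.X (i, 2) * D.chordFactor N i + H i) ∈ I := by
    intro i _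
    have e0 : D.columnForm N (i, 0) = MvPolynomial.C ((N : ℚ) + 2) * D.varLeft i -
        MvPolynomial.C (N : ℚ) * MvPolynomial.X (i, 2) + D.varInside i := by
      simp [columnForm_eq, blockZero, Fin.sum_univ_three, sub_eq_add_neg]
    have e1 : D.columnForm N (i, 1) = MvPolynomial.C ((N : ℚ) + 2) *
        (MvPolynomial.X (i, 2) - D.varRight i) + D.varInside i := by
      simp [columnForm_eq, blockZero, Fin.sum_univ_three]
      ring
    have e2 : D.columnForm N (i, 2) = - D.varRight i - MvPolynomial.X (i, 2) := by
      simp [columnForm_eq, blockZero, Fin.sum_univ_three, sub_eq_add_neg]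
    rw [Fin.prod_univ_three, e0, e1, e2]
    have h1 : D.varRight i ^ 2 ∈ I := MvPolynomial.sq_mem_squaresIdeal _
    have h2 : (MvPolynomial.X (i, 2) : MvPolynomial (D.Chord × Fin 3) ℚ) ^ 2 ∈ I :=
      MvPolynomial.sq_mem_squaresIdeal _
    have := add_mem (I.mul_mem_left (MvPolynomial.C ((N : ℚ) + 2) *
        (MvPolynomial.C ((N : ℚ) + 2) * D.varLeft i -
        MvPolynomial.C (N : ℚ) * MvPolynomial.X (i, 2) + D.varInside i)) (sub_mem h1 h2))
      (I.mul_mem_left (MvPolynomial.C (N : ℚ) * D.varInside i) h2)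
    convert this using 1
    simp only [H, chordFactor]
    ring
  have hX : ∀ (i : D.Chord) (c : Fin 3), c ≠ 2 →
      (MvPolynomial.X (i, c) : MvPolynomial (D.Chord × Fin 3) ℚ) ∈ MvPolynomial.supported ℚ
        (Set.range fun k : D.Chord => (k, (2 : Fin 3)))ᶜ := by
    intro i c hc
    rw [MvPolynomial.X_mem_supported]
    rintro ⟨k, hk⟩
    exact hc (congrArg Prod.snd hk).symm
  have hC : ∀ r : ℚ, (MvPolynomial.C r : MvPolynomial (D.Chord × Fin 3) ℚ) ∈
      MvPolynomial.supported ℚ (Set.range fun k : D.Chord => (k, (2 : Fin 3)))ᶜ :=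
    fun r => Subalgebra.algebraMap_mem _ r
  have hZ := D.varInside_mem_supported
  have hl := fun i => hX i 0 (by decide)
  have hr := fun i => hX i 1 (by decide)
  have hG : ∀ i, D.chordFactor N i ∈ MvPolynomial.supported ℚ
      (Set.range fun k : D.Chord => (k, (2 : Fin 3)))ᶜ := fun i =>
    sub_mem (sub_mem (mul_mem (mul_mem (hC _) (hr i)) (hZ i))
      (mul_mem (mul_mem (hC _) (hl i)) (hZ i))) (pow_mem (hZ i) 2)
  have hH : ∀ i, H i ∈ MvPolynomial.supported ℚ
      (Set.range fun k : D.Chord => (k, (2 : Fin 3)))ᶜ := fun i =>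
    mul_mem (mul_mem (neg_mem (add_mem (mul_mem (hC _) (hl i)) (hZ i))) (hZ i)) (hr i)
  have hprod := MvPolynomial.coeff_eq_of_sub_mem_squaresIdeal
    (MvPolynomial.prod_mul_sub_mem hcol 1) hd
  rw [eval_permanent_blownUpMatrix, Fintype.prod_prod_type, ← mul_one (∏ i, ∏ c, _), hprod,
    mul_one, sum_single_univ_eq]
  have := MvPolynomial.coeff_mul_prod_X_mul_add (fun i j h => congrArg Prod.fst h) hG hH
    (∑ p, Finsupp.single (D.endpointIndex p) 1) Finset.univ 1 (one_mem _)
  rwa [one_mul, one_mul] at this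

end

end ChordDiagram

noncomputable section

/-- The multiplication parts of the transposes of `chordOpLeft`. -/
def leftMul (N : ℕ) : Fin 4 → ℚ[X] :=
  ![0, C (N : ℚ) * X, C (1 / 2) * C (N : ℚ), C (-((N : ℚ) * ((N : ℚ) + 2) / 2)) * 1]

/-- The coefficients of the derivative in the transposes of `chordOpLeft`. -/
def leftDer (N : ℕ) : Fin 4 → ℚ[X] :=
  ![1, -X ^ 2, C (1 / 2) * (-2 * X), C (-((N : ℚ) * ((N : ℚ) + 2) / 2)) * 0]

/-- The multiplication parts of the transposes of `chordOpRight`. -/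
def rightMul (N : ℕ) : Fin 4 → ℚ[X] := ![C (N : ℚ) * X, 0, C (N : ℚ), 1]

/-- The coefficients of the derivative in the transposes of `chordOpRight`. -/
def rightDer : Fin 4 → ℚ[X] := ![-X ^ 2, 1, -2 * X, 0]

theorem actsAs_chordOpLeft (N : ℕ) (c : Fin 4) :
    ActsAs (chordOpLeft N c) (leftMul N c) (leftDer N c) := by
  fin_cases c
  exacts [actsAs_sl2F N, actsAs_sl2E N, (actsAs_sl2H N).smul _, (actsAs_one N).smul _]

theorem actsAs_chordOpRight (N : ℕ) (c : Fin 4) :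
    ActsAs (chordOpRight N c) (rightMul N c) (rightDer c) := by
  fin_cases c
  exacts [actsAs_sl2E N, actsAs_sl2F N, actsAs_sl2H N, actsAs_one N]

theorem sum_chordOp_symbols {A : Type*} [CommRing A] [Algebra ℚ A] (N : ℕ) (l r x y : A) :
    ∑ c, (l * aeval x (leftMul N c) + aeval x (leftDer N c)) *
        (r * aeval y (rightMul N c) + aeval y (rightDer c)) =
      -(x - y) ^ 2 + algebraMap ℚ A N * (x - y) * (l - r) - algebraMap ℚ A N * l * r := by
  have h2 : (2 : A) * algebraMap ℚ A 2⁻¹ = 1 := by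
    rw [← map_ofNat (algebraMap ℚ A) 2, ← map_mul]
    norm_num
  rw [Fin.sum_univ_four]
  simp [leftMul, leftDer, rightMul, rightDer, div_eq_mul_inv, map_ofNat (algebraMap ℚ A) 2,
    map_ofNat (aeval (R := ℚ) x) 2, map_ofNat (aeval (R := ℚ) y) 2]
  linear_combination (2 * x * y - N * x * r - N * y * l - N * l * r) * h2

namespace ChordDiagram

variable {m : ℕ} (D : ChordDiagram m)

theorem isHomogeneous_varInside (i : D.Chord) : (D.varInside i).IsHomogeneous 1 := by
  refine MvPolynomial.IsHomogeneous.sum _ _ _ fun q _ => ?_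
  split_ifs
  · exact MvPolynomial.isHomogeneous_X _ _
  · exact MvPolynomial.isHomogeneous_zero _ _ _

theorem isHomogeneous_chordFactor (N : ℕ) (i : D.Chord) :
    (D.chordFactor N i).IsHomogeneous 2 := by
  have hC : ∀ r : ℚ, (MvPolynomial.C r : MvPolynomial (D.Chord × Fin 3) ℚ).IsHomogeneous 0 :=
    fun r => MvPolynomial.isHomogeneous_C _ r
  have hX : ∀ v, (MvPolynomial.X v : MvPolynomial (D.Chord × Fin 3) ℚ).IsHomogeneous 1 :=
    fun v => MvPolynomial.isHomogeneous_X _ v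
  have hZ := D.isHomogeneous_varInside i
  exact ((((hC _).mul (hX _)).mul hZ).sub (((hC _).mul (hX _)).mul hZ)).sub (hZ.pow 2)

theorem eval_vecPoly_lineOp (N : ℕ) (w : Fin (N + 1) → ℚ) (x : ℚ) :
    eval x (vecPoly N ((D.lineOp N).transpose.mulVec w)) = MvPolynomial.coeff
      (∑ p, Finsupp.single (D.endpointIndex p) 1) (∏ i, D.chordFactor N i) *
        eval x (vecPoly N w) := by
  set d : D.Chord × Fin 3 →₀ ℕ := ∑ p, Finsupp.single (D.endpointIndex p) 1 with hd
  let pos : Fin (2 * m) → MvPolynomial (D.Chord × Fin 3) ℚ := fun p =>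
    MvPolynomial.C x + D.varBefore p
  let g : MvPolynomial (D.Chord × Fin 3) ℚ :=
    aeval (MvPolynomial.C x + ∑ q, MvPolynomial.X (D.endpointIndex q)) (vecPoly N w)
  have hop : ∀ (c : D.Chord → Fin 4) (p : Fin (2 * m)), ActsAs (D.endpointOp N c p)
      (if p < D.partner p then leftMul N (c (D.chordOf p)) else rightMul N (c (D.chordOf p)))
      (if p < D.partner p then leftDer N (c (D.chordOf p)) else rightDer (c (D.chordOf p))) := by
    intro c p
    rw [endpointOp]
    split_ifs
    exacts [actsAs_chordOpLeft N _, actsAs_chordOpRight N _]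
  let F : D.Chord → Fin 4 → MvPolynomial (D.Chord × Fin 3) ℚ := fun i a =>
    (D.varLeft i * aeval (pos (D.left i)) (leftMul N a) + aeval (pos (D.left i)) (leftDer N a)) *
      (D.varRight i * aeval (pos (D.right i)) (rightMul N a) +
        aeval (pos (D.right i)) (rightDer a))
  have hstate : ∀ c : D.Chord → Fin 4,
      eval x (vecPoly N ((List.ofFn fun p => D.endpointOp N c p).reverse.prod.transpose.mulVec w))
        = MvPolynomial.coeff d ((∏ i, F i (c i)) * g) := by
    intro c
    rw [eval_vecPoly_reverse_prod x D.endpointIndex_injective (hop c), D.prod_endpoints]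
    simp only [endpointIndex_left, endpointIndex_right, partner_left, partner_right,
      chordOf_left, chordOf_right, D.left_lt_right, (D.left_lt_right _).not_gt, if_true, if_false]
    rfl
  have hsum : ∑ c : D.Chord → Fin 4, ∏ i, F i (c i) = ∏ i, ∑ a, F i a := by
    rw [Finset.prod_univ_sum, Fintype.piFinset_univ]
  have hchord : ∀ i ∈ Finset.univ,
      (∑ a, F i a) - D.chordFactor N i ∈
        MvPolynomial.squaresIdeal (D.Chord × Fin 3) ℚ := by
    intro i _
    have := Ideal.mul_mem_left _ (-MvPolynomial.C ((N : ℚ) + 1))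
      (MvPolynomial.sq_mem_squaresIdeal (R := ℚ) ((i, 0) : D.Chord × Fin 3))
    convert this using 1
    simp only [F]
    rw [sum_chordOp_symbols, MvPolynomial.algebraMap_eq]
    simp only [pos, varBefore_right, chordFactor, map_add, map_one, map_ofNat]
    ring
  have hd1 : ∀ v, d v ≤ 1 := by
    intro v
    rw [hd, Finsupp.finsetSum_apply]
    simp only [Finsupp.single_apply]
    rw [Finset.sum_boole, Nat.cast_id, Finset.card_le_one]
    intro p hp q hq
    exact D.endpointIndex_injective
      ((Finset.mem_filter.1 hp).2.trans (Finset.mem_filter.1 hq).2.symm)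
  have hhom : (∏ i, D.chordFactor N i).IsHomogeneous (∑ _i : D.Chord, 2) :=
    MvPolynomial.IsHomogeneous.prod _ _ _ fun i _ => D.isHomogeneous_chordFactor N i
  have hdeg : d.degree = ∑ _i : D.Chord, 2 := by
    rw [hd, map_sum]
    simp only [Finsupp.degree_single]
    exact D.sum_endpoints _
  have hg : MvPolynomial.coeff 0 g = eval x (vecPoly N w) := by
    change MvPolynomial.constantCoeff (aeval _ _) = _
    rw [aeval_def, hom_eval₂]
    simp
  rw [lineOp, Matrix.transpose_sum, Matrix.sum_mulVec, map_sum, eval_finsetSum,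
    Finset.sum_congr rfl fun c _ => hstate c, ← MvPolynomial.coeff_sum, ← Finset.sum_mul, hsum,
    MvPolynomial.coeff_eq_of_sub_mem_squaresIdeal (MvPolynomial.prod_mul_sub_mem hchord g) hd1,
    MvPolynomial.coeff_mul_of_isHomogeneous hhom g hdeg, hg]

theorem lineOp_eq_smul_one (N : ℕ) :
    D.lineOp N = D.blownUpMatrix.permanent.eval (N : ℚ) • 1 := by
  rw [← Matrix.transpose_inj, Matrix.transpose_smul, Matrix.transpose_one]
  refine Matrix.ext_of_mulVec_single fun k => vecPoly_injective N (Polynomial.funext fun x => ?_)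
  rw [eval_vecPoly_lineOp, eval_permanent_eq_coeff_chordFactor, Matrix.smul_mulVec,
    Matrix.one_mulVec, map_smul, eval_smul, smul_eq_mul]

theorem isColoredJonesWeight_permanent : D.IsColoredJonesWeight D.blownUpMatrix.permanent := by
  intro N
  have h : (N : ℚ) + 1 ≠ 0 := by positivity
  rw [sl2Weight, lineOp_eq_smul_one, Matrix.trace_smul, Matrix.trace_one, Fintype.card_fin,
    smul_eq_mul, Nat.cast_add, Nat.cast_one, mul_div_cancel_right₀ _ h]

end ChordDiagram

end

/-- The colored Jones weight of every chord diagram is a well-defined polynomial, and it equals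
the permanent of the blown-up intersection matrix. -/
theorem theorem1 (m : ℕ) (D : ChordDiagram m) :
    D.IsColoredJonesWeight D.coloredJonesWeight ∧
      D.coloredJonesWeight = D.blownUpMatrix.permanent := by
  have hw : D.IsColoredJonesWeight D.coloredJonesWeight := by
    have h : ∃ w : ℚ[X], D.IsColoredJonesWeight w := ⟨_, D.isColoredJonesWeight_permanent⟩
    rw [ChordDiagram.coloredJonesWeight, dif_pos h]
    exact h.choose_spec
  exact ⟨hw, hw.unique D.isColoredJonesWeight_permanent⟩
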